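/- For $i\ge 1$ let $P_i$ denote the path with $i$ vertices. For an integer $r\ge 1$ put $n=16r-8$. Let $G_1'$ be the vertex-disjoint union of $r$ copies of $P_2$, $r-1$ copies of $P_3$, $r-1$ copies of $P_5$ and $r$ copies of $P_6$, let $G_2'$ be the vertex-disjoint union of $r-1$ copies of $P_2$, $r$ copies of $P_3$, $r$ copies of $P_5$ and $r-1$ copies of $P_6$, and let $G_1$ and $G_2$ be the complements of $G_1'$ and $G_2'$. An edge deletion trace of a graph $G$ with parameters $p_v,p_e\in[0,1]$ is the random unlabeled graph (isomorphism class) obtained by first keeping each vertex of $G$ independently with probability $p_v$, taking the induced subgraph on the kept vertices, and then deleting each edge of this subgraph independently with probability $1-p_e$. (a) For every $r\ge1$, the graphs $G_1$ and $G_2$ both have $n$ vertices and are not isomorphic. Nevertheless, let $E_1$ be the set of all pairs consisting of a leaf of a copy of $P_2$ in $G_1'$ and one of the two middle vertices of a copy of $P_6$ in $G_1'$, and let $E_2$ be the set of all pairs consisting of a leaf of a copy of $P_3$ in $G_2'$ and the middle vertex of a copy of $P_5$ in $G_2'$. Then $E_1$ and $E_2$ are non-empty sets of edges of $G_1$ and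 $G_2$ respectively, and $G_1-e_1\cong G_2-e_2$ for all $e_1\in E_1$ and $e_2\in E_2$. (b) $G_1$ and $G_2$ can be distinguished with high probability from $\exp(O(n^{1/3}\log^{2/3}n))$ traces in the edge deletion model with $p_v=1$ and $p_e=1/2$. That is, for every $c>0$ there is a constant $C>0$ such that for every $r\ge1$ there are an integer $0\le t\le \exp(Cn^{1/3}(\log n)^{2/3})$ and a decision rule which, given $t$ independent traces all generated from $G_1$ or all generated from $G_2$, decides which of the two graphs they come from, and which for each of the two graphs is correct with probability at least $1-n^{-c}$. -/

import Mathlib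

open MeasureTheory ProbabilityTheory

namespace GraphTrace

/-! ### Unlabeled finite graphs -/

/-- Two finite graphs are identified when they are isomorphic. -/
instance isoSetoid : Setoid (Σ k : ℕ, SimpleGraph (Fin k)) where
  r A B := Nonempty (A.2 ≃g B.2)
  iseqv :=
    { refl := fun _ => ⟨SimpleGraph.Iso.refl⟩
      symm := fun ⟨f⟩ => ⟨f.symm⟩
      trans := fun ⟨f⟩ ⟨g⟩ => ⟨f.trans g⟩ }

/-- An unlabeled finite graph: an isomorphism class of finite simple graphs. -/
def UnlabeledGraph : Type := Quotient isoSetoid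

/-- Every set of unlabeled graphs is an event. -/
instance : MeasurableSpace UnlabeledGraph := ⊤

instance : DiscreteMeasurableSpace UnlabeledGraph := ⟨fun _ => trivial⟩

instance : Countable UnlabeledGraph :=
  inferInstanceAs (Countable (Quotient isoSetoid))

/-- The unlabeled graph underlying a graph on a finite vertex type, that is, its isomorphism
class; see `unlabel_eq_iff`. -/
noncomputable def unlabel {V : Type*} [Finite V] (G : SimpleGraph V) : UnlabeledGraph :=
  Quotient.mk isoSetoid ⟨Nat.card V, G.map (Finite.equivFin V).toEmbedding⟩

theorem unlabel_eq_iff {V W : Type*} [Finite V] [Finite W] (G : SimpleGraph V)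
    (H : SimpleGraph W) : unlabel G = unlabel H ↔ Nonempty (G ≃g H) := by
  have hG : G ≃g G.map (Finite.equivFin V).toEmbedding := SimpleGraph.Iso.map (Finite.equivFin V) G
  have hH : H ≃g H.map (Finite.equivFin W).toEmbedding := SimpleGraph.Iso.map (Finite.equivFin W) H
  refine Iff.trans (Quotient.eq (r := isoSetoid)) ?_
  constructor
  · rintro ⟨f⟩
    exact ⟨(hG.trans f).trans hH.symm⟩
  · rintro ⟨f⟩
    exact ⟨(hG.symm.trans f).trans hH⟩

/-! ### Traces -/

/-- The law of an edge deletion trace of `G`. First a random vertex set `S` is drawn, each vertex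
being in `S` independently with probability `pv`. Then, among the edges of the induced subgraph
`G[S]`, a random set `F` of surviving edges is drawn, each edge being in `F` independently with
probability `pe` (and so deleted with probability `1 - pe`). The trace is the graph `(S, F)`,
without its vertex labels. -/
noncomputable def edgeDeletionTrace {V : Type*} [Finite V] (G : SimpleGraph V)
    (pv pe : unitInterval) : Measure UnlabeledGraph :=
  (setBernoulli (Set.univ : Set V) pv).bind fun S =>
    (setBernoulli (G.induce S).edgeSet pe).map fun F => unlabel (SimpleGraph.fromEdgeSet F)

instance {V : Type*} [Finite V] (G : SimpleGraph V) (pv pe : unitInterval) :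
    IsProbabilityMeasure (edgeDeletionTrace G pv pe) := by
  unfold edgeDeletionTrace
  refine isProbabilityMeasure_bind (Measurable.of_discrete).aemeasurable (ae_of_all _ fun S => ?_)
  exact Measure.isProbabilityMeasure_map (Measurable.of_discrete).aemeasurable

/-- `G` and `H` can be distinguished from `t` independent edge deletion traces with error
probability at most `δ`: some decision rule, which sees only the `t` unlabeled traces, answers
`G` (the value `true`) with probability at least `1 - δ` when the traces come from `G`, and answers
`H` (the value `false`) with probability at least `1 - δ` when they come from `H`. -/
def DistinguishableFromTraces {V W : Type*} [Finite V] [Finite W] (G : SimpleGraph V)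
    (H : SimpleGraph W) (pv pe : unitInterval) (t : ℕ) (δ : ℝ) : Prop :=
  ∃ rule : (Fin t → UnlabeledGraph) → Bool,
    1 - δ ≤ (Measure.pi fun _ : Fin t => edgeDeletionTrace G pv pe).real {x | rule x = true} ∧
    1 - δ ≤ (Measure.pi fun _ : Fin t => edgeDeletionTrace H pv pe).real {x | rule x = false}

/-! ### The two graphs -/

/-- The vertex disjoint union of `m` copies of `H`; the vertex `(i, x)` is the vertex `x` of the
`i`th copy. -/
def copies (m : ℕ) {V : Type*} (H : SimpleGraph V) : SimpleGraph (Fin m × V) where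
  Adj p q := p.1 = q.1 ∧ H.Adj p.2 q.2
  symm := ⟨fun _ _ h => ⟨h.1.symm, h.2.symm⟩⟩
  loopless := ⟨fun _ h => H.irrefl h.2⟩

/-- Vertices of the disjoint union of `a` copies of `P₂`, `b` copies of `P₃`, `c` copies of `P₅`
and `d` copies of `P₆`, where `Pᵢ` is the path with `i` vertices. -/
abbrev PathsVertex (a b c d : ℕ) : Type :=
  ((Fin a × Fin 2 ⊕ Fin b × Fin 3) ⊕ Fin c × Fin 5) ⊕ Fin d × Fin 6

open SimpleGraph in
/-- The disjoint union of `a` copies of `P₂`, `b` copies of `P₃`, `c` copies of `P₅` and `d`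
copies of `P₆`. -/
def disjointPaths (a b c d : ℕ) : SimpleGraph (PathsVertex a b c d) :=
  copies a (pathGraph 2) ⊕g copies b (pathGraph 3) ⊕g copies c (pathGraph 5) ⊕g
    copies d (pathGraph 6)

/-- The complement of the disjoint union of `r` copies of `P₂`, `r - 1` of `P₃`, `r - 1` of `P₅`
and `r` of `P₆`. -/
def graphOne (r : ℕ) : SimpleGraph (PathsVertex r (r - 1) (r - 1) r) :=
  (disjointPaths r (r - 1) (r - 1) r)ᶜ

/-- The complement of the disjoint union of `r - 1` copies of `P₂`, `r` of `P₃`, `r` of `P₅`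
and `r - 1` of `P₆`. -/
def graphTwo (r : ℕ) : SimpleGraph (PathsVertex (r - 1) r r (r - 1)) :=
  (disjointPaths (r - 1) r r (r - 1))ᶜ

/-- Pairs of a leaf of a copy of `P₂` and one of the two middle vertices (numbers `2` and `3`
among `0, …, 5`) of a copy of `P₆`. -/
def crossPairsOne (r : ℕ) : Set (Sym2 (PathsVertex r (r - 1) (r - 1) r)) :=
  {e | ∃ (i j : Fin r) (a : Fin 2) (b : Fin 6), (b = 2 ∨ b = 3) ∧
    e = s(Sum.inl (Sum.inl (Sum.inl (i, a))), Sum.inr (j, b))}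

/-- Pairs of a leaf (number `0` or `2`) of a copy of `P₃` and the middle vertex (number `2`) of a
copy of `P₅`. -/
def crossPairsTwo (r : ℕ) : Set (Sym2 (PathsVertex (r - 1) r r (r - 1))) :=
  {e | ∃ (k l : Fin r) (a : Fin 3), (a = 0 ∨ a = 2) ∧
    e = s(Sum.inl (Sum.inl (Sum.inr (k, a))), Sum.inl (Sum.inr (l, 2)))}

/-- The probability `1 / 2`. -/
noncomputable def oneHalf : unitInterval := ⟨1 / 2, by norm_num, by norm_num⟩

end GraphTrace

/-!
The two graphs are complements of disjoint unions of paths, and everything is read off from these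
unions.

Deleting an edge of a complement is adding it to the original graph (`compl_deleteEdges_singleton`).
Joining a leaf of `P₂` to a middle vertex of `P₆`, or a leaf of `P₃` to the middle vertex of `P₅`,
gives the same tree, the spider with legs of lengths `2`, `2` and `3` (`nonempty_spider_iso`), and
what is left over consists on both sides of `r - 1` copies of each of `P₂`, `P₃`, `P₅` and `P₆`.

The graphs are told apart by the number of copies of `P₄` in the complement. Counted with both
directions, `P₅` contains four and `P₆` contains six of them, while `P₂` and `P₃` contain none, so
the counts differ by `2` (`pathCount_compl_graphOne`); in particular the graphs are not isomorphic.

This count has a simple unbiased estimator from a trace in which every vertex is kept and every edge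
survives with probability `1 / 2`. Give a pair of vertices the sign `-1` if it is an edge of the
trace and `1` otherwise. A pair that is not an edge of the original graph has sign `1`, and an edge
of the original graph has a uniformly random sign, of mean zero. Since the three pairs along a path
are distinct, the product of their signs has mean `1` if the path lies in the complement of the
original graph and mean `0` otherwise. So the sum of these products over all quadruples of distinct
vertices has the number of paths in the complement as its mean (`integral_traceStatistic`), and it
is an isomorphism invariant of the trace, bounded by `n ^ 4`. By Chebyshev's inequality its average
over polynomially many traces separates the two graphs
(`distinguishableFromTraces_of_statistic`), which is well within the number of traces allowed.
-/

namespace GraphTrace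

open SimpleGraph

/-! ### Adding an edge to a union of paths -/

section Isomorphisms

variable {V W : Type*}

theorem nonempty_compl_iso {G : SimpleGraph V} {H : SimpleGraph W} (h : Nonempty (G ≃g H)) :
    Nonempty (Gᶜ ≃g Hᶜ) := by
  obtain ⟨e⟩ := h
  exact ⟨⟨e.toEquiv, fun {x y} => by
    change Hᶜ.Adj (e x) (e y) ↔ _
    simp [compl_adj, e.map_adj_iff, e.injective.eq_iff]⟩⟩

theorem compl_deleteEdges_singleton (G : SimpleGraph V) (x y : V) :
    Gᶜ.deleteEdges {s(x, y)} = (G ⊔ edge x y)ᶜ := by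
  ext u v
  simp only [deleteEdges_adj, compl_adj, sup_adj, edge_adj, Set.mem_singleton_iff, Sym2.eq_iff]
  tauto

theorem nonempty_sup_edge_iso {G : SimpleGraph V} {H : SimpleGraph W} (e : G ≃g H) (x y : V) :
    Nonempty ((G ⊔ edge x y) ≃g (H ⊔ edge (e x) (e y))) :=
  ⟨⟨e.toEquiv, fun {u v} => by
    change (H ⊔ edge (e x) (e y)).Adj (e u) (e v) ↔ _
    simp [edge_adj, e.map_adj_iff, e.injective.eq_iff]⟩⟩

theorem sum_sup_edge_inr (G : SimpleGraph V) (H : SimpleGraph W) (x y : W) :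
    (G ⊕g H) ⊔ edge (Sum.inr x) (Sum.inr y) = G ⊕g (H ⊔ edge x y) := by
  ext (u | u) (v | v) <;> simp [edge_adj]

/-- If `D₁` and `D₂` split off a common part `R`, leaving parts `A₁` and `A₂` that become isomorphic
once an edge is added to each, then the complements of `D₁` and `D₂` become isomorphic once the
corresponding edges are deleted. -/
theorem nonempty_iso_of_common_part {U V₁ V₂ W₁ W₂ : Type*} {R : SimpleGraph U}
    {A₁ : SimpleGraph W₁} {A₂ : SimpleGraph W₂} {D₁ : SimpleGraph V₁} {D₂ : SimpleGraph V₂}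
    (φ₁ : (R ⊕g A₁) ≃g D₁) (φ₂ : (R ⊕g A₂) ≃g D₂) {x₁ y₁ : W₁} {x₂ y₂ : W₂}
    (h : Nonempty ((A₁ ⊔ edge x₁ y₁) ≃g (A₂ ⊔ edge x₂ y₂))) :
    Nonempty (D₁ᶜ.deleteEdges {s(φ₁ (.inr x₁), φ₁ (.inr y₁))} ≃g
      D₂ᶜ.deleteEdges {s(φ₂ (.inr x₂), φ₂ (.inr y₂))}) := by
  rw [compl_deleteEdges_singleton, compl_deleteEdges_singleton]
  apply nonempty_compl_iso
  obtain ⟨e₁⟩ := nonempty_sup_edge_iso φ₁ (.inr x₁) (.inr y₁)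
  obtain ⟨e₂⟩ := nonempty_sup_edge_iso φ₂ (.inr x₂) (.inr y₂)
  rw [sum_sup_edge_inr] at e₁ e₂
  obtain ⟨σ⟩ := h
  exact ⟨e₁.symm.trans ((Iso.sumCongr Iso.refl σ).trans e₂)⟩

/-- Singling out the `i`th of `s + 1` copies of `H`. -/
noncomputable def copiesSuccIso (H : SimpleGraph V) {s : ℕ} (i : Fin (s + 1)) :
    (copies s H ⊕g H) ≃g copies (s + 1) H where
  toEquiv := Equiv.ofBijective (Sum.elim (fun p => (i.succAbove p.1, p.2)) fun v => (i, v)) <| by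
    constructor
    · rintro (⟨j, u⟩ | u) (⟨k, v⟩ | v) <;> simp [Fin.succAbove_ne, (Fin.succAbove_ne _ _).symm]
    · rintro ⟨j, v⟩
      rcases Fin.eq_self_or_eq_succAbove i j with rfl | ⟨k, rfl⟩
      · exact ⟨.inr v, rfl⟩
      · exact ⟨.inl (k, v), rfl⟩
  map_rel_iff' {p q} := by
    change (copies (s + 1) H).Adj
        (Sum.elim (fun p : Fin s × V => (i.succAbove p.1, p.2)) (fun v => (i, v)) p)
        (Sum.elim (fun p : Fin s × V => (i.succAbove p.1, p.2)) (fun v => (i, v)) q) ↔ _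
    rcases p with ⟨j, u⟩ | u <;> rcases q with ⟨k, v⟩ | v <;>
      simp [copies, Fin.succAbove_ne, (Fin.succAbove_ne _ _).symm]

/-- Gathering the second summands of the first and the last of four parts of a disjoint union. -/
def sumShuffleOuter {A B C D X Y : Type*} (gA : SimpleGraph A) (gB : SimpleGraph B)
    (gC : SimpleGraph C) (gD : SimpleGraph D) (gX : SimpleGraph X) (gY : SimpleGraph Y) :
    ((gA ⊕g gB ⊕g gC ⊕g gD) ⊕g (gX ⊕g gY)) ≃g ((gA ⊕g gX) ⊕g gB ⊕g gC ⊕g (gD ⊕g gY)) where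
  toFun
    | .inl (.inl (.inl (.inl a))) => .inl (.inl (.inl (.inl a)))
    | .inl (.inl (.inl (.inr b))) => .inl (.inl (.inr b))
    | .inl (.inl (.inr c)) => .inl (.inr c)
    | .inl (.inr d) => .inr (.inl d)
    | .inr (.inl x) => .inl (.inl (.inl (.inr x)))
    | .inr (.inr y) => .inr (.inr y)
  invFun
    | .inl (.inl (.inl (.inl a))) => .inl (.inl (.inl (.inl a)))
    | .inl (.inl (.inr b)) => .inl (.inl (.inl (.inr b)))
    | .inl (.inr c) => .inl (.inl (.inr c))
    | .inr (.inl d) => .inl (.inr d)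
    | .inl (.inl (.inl (.inr x))) => .inr (.inl x)
    | .inr (.inr y) => .inr (.inr y)
  left_inv := by rintro ((((_ | _) | _) | _) | (_ | _)) <;> rfl
  right_inv := by rintro ((((_ | _) | _) | _) | (_ | _)) <;> rfl
  map_rel_iff' {p q} := by
    rcases p with ((((_ | _) | _) | _) | (_ | _)) <;>
      rcases q with ((((_ | _) | _) | _) | (_ | _)) <;> simp

/-- Gathering the second summands of the two inner parts of a disjoint union of four parts. -/
def sumShuffleInner {A B C D X Y : Type*} (gA : SimpleGraph A) (gB : SimpleGraph B)
    (gC : SimpleGraph C) (gD : SimpleGraph D) (gX : SimpleGraph X) (gY : SimpleGraph Y) :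
    ((gA ⊕g gB ⊕g gC ⊕g gD) ⊕g (gX ⊕g gY)) ≃g (gA ⊕g (gB ⊕g gX) ⊕g (gC ⊕g gY) ⊕g gD) where
  toFun
    | .inl (.inl (.inl (.inl a))) => .inl (.inl (.inl a))
    | .inl (.inl (.inl (.inr b))) => .inl (.inl (.inr (.inl b)))
    | .inl (.inl (.inr c)) => .inl (.inr (.inl c))
    | .inl (.inr d) => .inr d
    | .inr (.inl x) => .inl (.inl (.inr (.inr x)))
    | .inr (.inr y) => .inl (.inr (.inr y))
  invFun
    | .inl (.inl (.inl a)) => .inl (.inl (.inl (.inl a)))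
    | .inl (.inl (.inr (.inl b))) => .inl (.inl (.inl (.inr b)))
    | .inl (.inr (.inl c)) => .inl (.inl (.inr c))
    | .inr d => .inl (.inr d)
    | .inl (.inl (.inr (.inr x))) => .inr (.inl x)
    | .inl (.inr (.inr y)) => .inr (.inr y)
  left_inv := by rintro ((((_ | _) | _) | _) | (_ | _)) <;> rfl
  right_inv := by rintro (((_ | (_ | _)) | (_ | _)) | _) <;> rfl
  map_rel_iff' {p q} := by
    rcases p with ((((_ | _) | _) | _) | (_ | _)) <;>
      rcases q with ((((_ | _) | _) | _) | (_ | _)) <;> simp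

/-- The reflection of a path. -/
def pathGraphRev (m : ℕ) : pathGraph m ≃g pathGraph m where
  toEquiv := Fin.revPerm
  map_rel_iff' {x y} := by
    simp only [pathGraph_adj, Fin.revPerm_apply, Fin.val_rev]
    omega

/-- Both trees are the spider with legs of lengths `2`, `2` and `3`: in the first the added edge
begins a leg of length `2` ending in `P₂`, in the second a leg of length `3` formed with `P₃`. -/
theorem nonempty_spider_iso_base :
    Nonempty (((pathGraph 2 ⊕g pathGraph 6) ⊔ edge (.inl 0) (.inr 2)) ≃g
      ((pathGraph 3 ⊕g pathGraph 5) ⊔ edge (.inl 0) (.inr 2))) := by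
  let f : Fin 2 ⊕ Fin 6 → Fin 3 ⊕ Fin 5 :=
    Sum.elim ![.inr 3, .inr 4] ![.inr 0, .inr 1, .inr 2, .inl 0, .inl 1, .inl 2]
  have hf : Function.Bijective f := by decide
  refine ⟨⟨Equiv.ofBijective f hf, fun {x y} => ?_⟩⟩
  rcases x with x | x <;> rcases y with y | y <;> fin_cases x <;> fin_cases y <;>
    simp [f, pathGraph_adj, edge_adj]

theorem nonempty_spider_iso {a : Fin 2} {b : Fin 6} {c : Fin 3} (hb : b = 2 ∨ b = 3)
    (hc : c = 0 ∨ c = 2) :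
    Nonempty (((pathGraph 2 ⊕g pathGraph 6) ⊔ edge (.inl a) (.inr b)) ≃g
      ((pathGraph 3 ⊕g pathGraph 5) ⊔ edge (.inl c) (.inr 2))) := by
  have flip : ∀ {m : ℕ} (x y : Fin m), x = y ∨ x = y.rev →
      ∃ e : pathGraph m ≃g pathGraph m, e x = y := by
    rintro m x y (rfl | rfl)
    · exact ⟨Iso.refl, rfl⟩
    · exact ⟨pathGraphRev m, Fin.rev_rev y⟩
  -- By reflecting the three paths, the added edges may be assumed to be the ones of the base case.
  obtain ⟨α, hα⟩ := flip a 0 (by decide +revert)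
  obtain ⟨β, hβ⟩ := flip b 2 (by rcases hb with rfl | rfl <;> decide)
  obtain ⟨γ, hγ⟩ := flip c 0 (by rcases hc with rfl | rfl <;> decide)
  obtain ⟨e₁⟩ := nonempty_sup_edge_iso (Iso.sumCongr α β) (.inl a) (.inr b)
  obtain ⟨e₂⟩ := nonempty_sup_edge_iso (Iso.sumCongr γ (Iso.refl (G := pathGraph 5)))
    (.inl c) (.inr 2)
  obtain ⟨e⟩ := nonempty_spider_iso_base
  simp only [Iso.sumCongr_apply, Sum.map_inl, Sum.map_inr, hα, hβ, hγ] at e₁ e₂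
  exact ⟨e₁.trans (e.trans e₂.symm)⟩

theorem nonempty_deleteEdges_iso (s : ℕ) {e₁ e₂} (h₁ : e₁ ∈ crossPairsOne (s + 1))
    (h₂ : e₂ ∈ crossPairsTwo (s + 1)) :
    Nonempty ((graphOne (s + 1)).deleteEdges {e₁} ≃g (graphTwo (s + 1)).deleteEdges {e₂}) := by
  obtain ⟨i, j, a, b, hb, rfl⟩ := h₁
  obtain ⟨k, l, c, hc, rfl⟩ := h₂
  exact nonempty_iso_of_common_part
    ((sumShuffleOuter (copies s (pathGraph 2)) (copies s (pathGraph 3)) (copies s (pathGraph 5))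
      (copies s (pathGraph 6)) (pathGraph 2) (pathGraph 6)).trans <|
      Iso.sumCongr (Iso.sumCongr (Iso.sumCongr (copiesSuccIso _ i) Iso.refl) Iso.refl)
        (copiesSuccIso _ j))
    ((sumShuffleInner (copies s (pathGraph 2)) (copies s (pathGraph 3)) (copies s (pathGraph 5))
      (copies s (pathGraph 6)) (pathGraph 3) (pathGraph 5)).trans <|
      Iso.sumCongr (Iso.sumCongr (Iso.sumCongr Iso.refl (copiesSuccIso _ k)) (copiesSuccIso _ l))
        Iso.refl)
    (nonempty_spider_iso (a := a) hb hc)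

theorem crossPairsOne_nonempty (s : ℕ) : (crossPairsOne (s + 1)).Nonempty :=
  ⟨_, 0, 0, 0, 2, .inl rfl, rfl⟩

theorem crossPairsTwo_nonempty (s : ℕ) : (crossPairsTwo (s + 1)).Nonempty :=
  ⟨_, 0, 0, 0, .inl rfl, rfl⟩

theorem crossPairsOne_subset (r : ℕ) : crossPairsOne r ⊆ (graphOne r).edgeSet := by
  rintro _ ⟨i, j, a, b, -, rfl⟩
  simp [graphOne, disjointPaths]

theorem crossPairsTwo_subset (r : ℕ) : crossPairsTwo r ⊆ (graphTwo r).edgeSet := by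
  rintro _ ⟨k, l, a, -, rfl⟩
  simp [graphTwo, disjointPaths]

theorem card_pathsVertex (a b c d : ℕ) :
    Nat.card (PathsVertex a b c d) = 2 * a + 3 * b + 5 * c + 6 * d := by
  simp only [Nat.card_eq_fintype_card, Fintype.card_sum, Fintype.card_prod, Fintype.card_fin]
  ring

end Isomorphisms

/-! ### Counting paths with four vertices -/

open Classical in
/-- The sum, over all ordered quadruples of distinct vertices, of the product of the weights of the
three consecutive pairs. Only weights of pairs of distinct vertices enter. -/
noncomputable def pathSum {V : Type*} [Fintype V] (w : V → V → ℝ) : ℝ :=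
  ∑ a, ∑ b, ∑ c, ∑ d, if [a, b, c, d].Nodup then w a b * w b c * w c d else 0

theorem pathSum_comp_equiv {V W : Type*} [Fintype V] [Fintype W] (e : V ≃ W) (w : W → W → ℝ) :
    pathSum (fun x y => w (e x) (e y)) = pathSum w := by
  classical
  unfold pathSum
  refine Fintype.sum_equiv e _ _ fun a => Fintype.sum_equiv e _ _ fun b =>
    Fintype.sum_equiv e _ _ fun c => Fintype.sum_equiv e _ _ fun d => ?_
  have : [e a, e b, e c, e d].Nodup ↔ [a, b, c, d].Nodup :=
    List.nodup_map_iff (l := [a, b, c, d]) e.injective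
  exact if_congr this.symm rfl rfl

theorem abs_pathSum_le {V : Type*} [Fintype V] {w : V → V → ℝ} (hw : ∀ x y, |w x y| ≤ 1) :
    |pathSum w| ≤ (Nat.card V : ℝ) ^ 4 := by
  have term : ∀ a b c d, |w a b * w b c * w c d| ≤ 1 := fun a b c d => by
    rw [abs_mul, abs_mul]
    exact mul_le_one₀ (mul_le_one₀ (hw _ _) (abs_nonneg _) (hw _ _)) (abs_nonneg _) (hw _ _)
  have key : ∀ {f : V → ℝ} {K : ℝ}, (∀ v, |f v| ≤ K) → |∑ v, f v| ≤ Nat.card V * K := by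
    intro f K h
    refine (Finset.abs_sum_le_sum_abs _ _).trans ((Finset.sum_le_sum fun v _ => h v).trans_eq ?_)
    simp
  calc |pathSum w| ≤ Nat.card V * (Nat.card V * (Nat.card V * (Nat.card V * 1))) := by
        refine key fun a => key fun b => key fun c => key fun d => ?_
        split_ifs
        · exact term a b c d
        · simp
    _ = (Nat.card V : ℝ) ^ 4 := by ring

open Classical in
/-- The number of copies of the path `P₄` in `G` as a not necessarily induced subgraph, each
counted once for each of its two directions. -/
noncomputable def pathCount {V : Type*} [Fintype V] (G : SimpleGraph V) : ℝ :=
  pathSum fun x y => if G.Adj x y then 1 else 0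

theorem pathCount_congr {V W : Type*} [Fintype V] [Fintype W] {G : SimpleGraph V}
    {H : SimpleGraph W} (e : G ≃g H) : pathCount G = pathCount H := by
  classical
  rw [pathCount, pathCount, ← pathSum_comp_equiv e.toEquiv]
  congr! 4
  exact e.map_adj_iff.symm

theorem pathCount_sum {V W : Type*} [Fintype V] [Fintype W] (G : SimpleGraph V)
    (H : SimpleGraph W) : pathCount (G ⊕g H) = pathCount G + pathCount H := by
  have inl_nodup : ∀ a b c d : V,
      [(.inl a : V ⊕ W), .inl b, .inl c, .inl d].Nodup ↔ [a, b, c, d].Nodup := fun a b c d =>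
    List.nodup_map_iff (l := [a, b, c, d]) Sum.inl_injective
  have inr_nodup : ∀ a b c d : W,
      [(.inr a : V ⊕ W), .inr b, .inr c, .inr d].Nodup ↔ [a, b, c, d].Nodup := fun a b c d =>
    List.nodup_map_iff (l := [a, b, c, d]) Sum.inr_injective
  simp only [pathCount, pathSum, Fintype.sum_sum_type]
  simp [-List.nodup_cons]
  congr! 10
  exacts [inl_nodup _ _ _ _, inr_nodup _ _ _ _]

theorem pathCount_eq_natCast {V : Type*} [Fintype V] [DecidableEq V] (G : SimpleGraph V)
    [DecidableRel G.Adj] :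
    pathCount G = ((∑ a, ∑ b, ∑ c, ∑ d,
      if [a, b, c, d].Nodup ∧ G.Adj a b ∧ G.Adj b c ∧ G.Adj c d then 1 else 0 : ℕ) : ℝ) := by
  classical
  simp only [pathCount, pathSum]
  push_cast
  refine Finset.sum_congr rfl fun a _ => Finset.sum_congr rfl fun b _ =>
    Finset.sum_congr rfl fun c _ => Finset.sum_congr rfl fun d _ => ?_
  by_cases h : [a, b, c, d].Nodup
  · by_cases h₁ : G.Adj a b <;> by_cases h₂ : G.Adj b c <;> by_cases h₃ : G.Adj c d <;>
      simp [-List.nodup_cons, h, h₁, h₂, h₃]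
  · rw [if_neg h, if_neg (fun h' => h h'.1)]

instance (m : ℕ) : DecidableRel (pathGraph m).Adj := fun _ _ =>
  decidable_of_iff' _ pathGraph_adj

theorem pathCount_pathGraph_two : pathCount (pathGraph 2) = 0 := by
  rw [pathCount_eq_natCast]
  exact_mod_cast (by decide +kernel)

theorem pathCount_pathGraph_three : pathCount (pathGraph 3) = 0 := by
  rw [pathCount_eq_natCast]
  exact_mod_cast (by decide +kernel)

theorem pathCount_pathGraph_five : pathCount (pathGraph 5) = 4 := by
  rw [pathCount_eq_natCast]
  exact_mod_cast (by decide +kernel)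

theorem pathCount_pathGraph_six : pathCount (pathGraph 6) = 6 := by
  rw [pathCount_eq_natCast]
  exact_mod_cast (by decide +kernel)

theorem pathCount_copies {V : Type*} [Fintype V] (m : ℕ) (H : SimpleGraph V) :
    pathCount (copies m H) = m * pathCount H := by
  induction m with
  | zero => simp [pathCount, pathSum]
  | succ m ih =>
    rw [← pathCount_congr (copiesSuccIso H 0), pathCount_sum, ih]
    push_cast
    ring

theorem pathCount_disjointPaths (a b c d : ℕ) :
    pathCount (disjointPaths a b c d) = 4 * c + 6 * d := by
  rw [disjointPaths, pathCount_sum, pathCount_sum, pathCount_sum]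
  simp only [pathCount_copies, pathCount_pathGraph_two, pathCount_pathGraph_three,
    pathCount_pathGraph_five, pathCount_pathGraph_six]
  ring

theorem pathCount_compl_graphOne (s : ℕ) :
    pathCount (graphOne (s + 1))ᶜ = pathCount (graphTwo (s + 1))ᶜ + 2 := by
  rw [graphOne, graphTwo, compl_compl, compl_compl, pathCount_disjointPaths,
    pathCount_disjointPaths, Nat.add_sub_cancel]
  push_cast
  ring

theorem isEmpty_graphOne_iso_graphTwo (s : ℕ) :
    IsEmpty (graphOne (s + 1) ≃g graphTwo (s + 1)) := by
  refine ⟨fun e => ?_⟩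
  obtain ⟨e'⟩ := nonempty_compl_iso ⟨e⟩
  linarith [pathCount_congr e', pathCount_compl_graphOne s]

/-! ### Signs of the edges of a random subgraph -/

/-- Toggling the membership of a point of `u` preserves the uniform law on the subsets of `u`, so
a function which changes sign under this toggling has mean zero. -/
theorem integral_setBernoulli_eq_zero_of_flip {α : Type*} [Finite α] {u : Set α} {e : α}
    (he : e ∈ u) {f : Set α → ℝ} (hf : ∀ F, f (symmDiff F {e}) = -f F) :
    ∫ F, f F ∂setBernoulli u oneHalf = 0 := by
  classical
  have := Fintype.ofFinite α
  have mass : ∀ F : Set α, (setBernoulli u oneHalf).real {F} =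
      if F ⊆ u then (1 / 2 : ℝ) ^ u.ncard else 0 := by
    intro F
    split_ifs with h
    · rw [setBernoulli_real_singleton oneHalf h u.toFinite, ← Set.ncard_sdiff_add_ncard_of_subset h,
        pow_add, mul_comm]
      norm_num [oneHalf]
    · simp [measureReal_def, setBernoulli_singleton_of_not_subset oneHalf h]
  have sub : ∀ F : Set α, symmDiff F {e} ⊆ u ↔ F ⊆ u := by
    intro F
    simp only [Set.subset_def, Set.mem_symmDiff, Set.mem_singleton_iff]
    constructor
    · intro h x hx
      by_cases hxe : x = e
      · exact hxe ▸ he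
      · exact h x (.inl ⟨hx, hxe⟩)
    · rintro h x (⟨hx, -⟩ | ⟨rfl, -⟩)
      exacts [h x hx, he]
  have flip : Function.Involutive fun F : Set α => symmDiff F {e} := fun F =>
    symmDiff_symmDiff_cancel_right _ _
  rw [integral_fintype .of_finite]
  have := Equiv.sum_comp (flip.toPerm _) fun F => (setBernoulli u oneHalf).real {F} • f F
  simp only [Function.Involutive.coe_toPerm, mass, sub, hf, smul_neg, Finset.sum_neg_distrib]
    at this ⊢
  linarith

open Classical in
/-- The sign of `e` relative to `F`: `-1` if `e` belongs to `F`, and `1` otherwise. -/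
noncomputable def edgeSign {α : Type*} (F : Set α) (e : α) : ℝ := if e ∈ F then -1 else 1

theorem edgeSign_symmDiff_self {α : Type*} (F : Set α) (e : α) :
    edgeSign (symmDiff F {e}) e = -edgeSign F e := by
  by_cases h : e ∈ F <;> simp [edgeSign, Set.mem_symmDiff, h]

theorem edgeSign_symmDiff_of_ne {α : Type*} (F : Set α) {e e' : α} (h : e' ≠ e) :
    edgeSign (symmDiff F {e}) e' = edgeSign F e' := by
  by_cases h' : e' ∈ F <;> simp [edgeSign, Set.mem_symmDiff, h, h']

open Classical in
/-- The sign of an element of `u` has mean zero and the sign of any other element is almost surely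
`1`, and the signs of distinct elements are independent. -/
theorem integral_edgeSign_mul_mul {α : Type*} [Finite α] (u : Set α) {e₁ e₂ e₃ : α}
    (h₁₂ : e₁ ≠ e₂) (h₁₃ : e₁ ≠ e₃) (h₂₃ : e₂ ≠ e₃) :
    ∫ F, edgeSign F e₁ * edgeSign F e₂ * edgeSign F e₃ ∂setBernoulli u oneHalf =
      if e₁ ∉ u ∧ e₂ ∉ u ∧ e₃ ∉ u then 1 else 0 := by
  split_ifs with h
  · have : ∀ᵐ F ∂setBernoulli u oneHalf, edgeSign F e₁ * edgeSign F e₂ * edgeSign F e₃ = 1 := by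
      filter_upwards [setBernoulli_ae_subset] with F hF
      simp [edgeSign, mt (@hF e₁) h.1, mt (@hF e₂) h.2.1, mt (@hF e₃) h.2.2]
    rw [integral_congr_ae this]
    simp
  · have : e₁ ∈ u ∨ e₂ ∈ u ∨ e₃ ∈ u := by tauto
    rcases this with he | he | he <;>
      refine integral_setBernoulli_eq_zero_of_flip he fun F => ?_
    · rw [edgeSign_symmDiff_self, edgeSign_symmDiff_of_ne F h₁₂.symm,
        edgeSign_symmDiff_of_ne F h₁₃.symm]
      ring
    · rw [edgeSign_symmDiff_self, edgeSign_symmDiff_of_ne F h₁₂,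
        edgeSign_symmDiff_of_ne F h₂₃.symm]
      ring
    · rw [edgeSign_symmDiff_self, edgeSign_symmDiff_of_ne F h₁₃,
        edgeSign_symmDiff_of_ne F h₂₃]
      ring

/-! ### The statistic of a trace -/

open Classical in
/-- The sum over quadruples of distinct vertices of the product of three signs, one for each
consecutive pair: `-1` for an edge of `F`, and `1` for a pair that is not an edge. -/
noncomputable def signedPathSum {V : Type*} [Fintype V] (F : SimpleGraph V) : ℝ :=
  pathSum fun x y => if F.Adj x y then -1 else 1

theorem signedPathSum_congr {V W : Type*} [Fintype V] [Fintype W] {G : SimpleGraph V}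
    {H : SimpleGraph W} (e : G ≃g H) : signedPathSum G = signedPathSum H := by
  classical
  rw [signedPathSum, signedPathSum, ← pathSum_comp_equiv e.toEquiv]
  congr! 4
  exact e.map_adj_iff.symm

/-- The statistic `signedPathSum`, as a function of the unlabeled graph. -/
noncomputable def traceStatistic : UnlabeledGraph → ℝ :=
  Quotient.lift (fun A : Σ k : ℕ, SimpleGraph (Fin k) => signedPathSum A.2)
    fun _ _ ⟨e⟩ => signedPathSum_congr e

theorem traceStatistic_unlabel {V : Type*} [Fintype V] (F : SimpleGraph V) :
    traceStatistic (unlabel F) = signedPathSum F :=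
  (signedPathSum_congr (SimpleGraph.Iso.map (Finite.equivFin V) F)).symm

theorem abs_signedPathSum_le {V : Type*} [Fintype V] (F : SimpleGraph V) :
    |signedPathSum F| ≤ (Nat.card V : ℝ) ^ 4 := by
  refine abs_pathSum_le fun x y => ?_
  split_ifs <;> simp

/-- The signed path sum of the random subgraph of `K` is an unbiased estimator of the number of
paths in the complement of `K`. -/
theorem integral_signedPathSum {V : Type*} [Fintype V] (K : SimpleGraph V) :
    ∫ F, signedPathSum (fromEdgeSet F) ∂setBernoulli K.edgeSet oneHalf = pathCount Kᶜ := by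
  classical
  unfold signedPathSum pathCount pathSum
  rw [integral_finsetSum _ fun _ _ => .of_finite]
  refine Finset.sum_congr rfl fun a _ => ?_
  rw [integral_finsetSum _ fun _ _ => .of_finite]
  refine Finset.sum_congr rfl fun b _ => ?_
  rw [integral_finsetSum _ fun _ _ => .of_finite]
  refine Finset.sum_congr rfl fun c _ => ?_
  rw [integral_finsetSum _ fun _ _ => .of_finite]
  refine Finset.sum_congr rfl fun d _ => ?_
  split_ifs with h
  · simp only [List.nodup_cons, List.mem_cons, List.not_mem_nil, or_false, not_or] at h
    obtain ⟨⟨hab, hac, had⟩, ⟨hbc, hbd⟩, hcd, -⟩ := h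
    have := integral_edgeSign_mul_mul K.edgeSet (e₁ := s(a, b)) (e₂ := s(b, c)) (e₃ := s(c, d))
      (by simp [hab, hac]) (by simp [hac, had]) (by simp [hbc, hbd])
    simp only [edgeSign, mem_edgeSet] at this
    simp only [fromEdgeSet_adj, compl_adj, ne_eq, hab, hbc, hcd, not_false_eq_true, and_true,
      true_and, this]
    simp only [ite_and, mul_ite, mul_one, mul_zero]
    split_ifs <;> rfl
  · simp

theorem edgeDeletionTrace_one {V : Type*} [Finite V] (G : SimpleGraph V) (pe : unitInterval) :
    edgeDeletionTrace G 1 pe =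
      (setBernoulli (G.induce Set.univ).edgeSet pe).map fun F => unlabel (fromEdgeSet F) := by
  rw [edgeDeletionTrace, setBernoulli_one, Measure.dirac_bind (Measurable.of_discrete)]

theorem integral_traceStatistic {V : Type*} [Fintype V] (G : SimpleGraph V) :
    ∫ x, traceStatistic x ∂edgeDeletionTrace G 1 oneHalf = pathCount Gᶜ := by
  rw [edgeDeletionTrace_one, integral_map (Measurable.of_discrete).aemeasurable
    (Measurable.of_discrete).aestronglyMeasurable]
  simp only [traceStatistic_unlabel]
  rw [integral_signedPathSum]
  refine pathCount_congr ⟨Equiv.Set.univ V, fun {x y} => ?_⟩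
  simp [compl_adj, Subtype.ext_iff]

theorem abs_traceStatistic_le {V : Type*} [Fintype V] (G : SimpleGraph V) :
    ∀ᵐ x ∂edgeDeletionTrace G 1 oneHalf, |traceStatistic x| ≤ (Nat.card V : ℝ) ^ 4 := by
  rw [edgeDeletionTrace_one, ae_map_iff (Measurable.of_discrete).aemeasurable .of_discrete]
  refine ae_of_all _ fun F => ?_
  rw [traceStatistic_unlabel]
  convert abs_signedPathSum_le (fromEdgeSet F) using 3
  exact (Nat.card_univ).symm

/-! ### Distinguishing by the mean of a statistic -/

/-- Chebyshev's inequality for the sum of `t` independent samples of a bounded statistic. -/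
theorem measureReal_pi_le_of_average {Ω : Type*} [MeasurableSpace Ω] (μ : Measure Ω)
    [IsProbabilityMeasure μ] {f : Ω → ℝ} (hf : Measurable f) {M : ℝ}
    (hM : ∀ᵐ x ∂μ, |f x| ≤ M) {t : ℕ} (ht : 0 < t) {ε : ℝ} (hε : 0 < ε) :
    (Measure.pi fun _ : Fin t => μ).real {x | t * ε ≤ |∑ i, f (x i) - t * ∫ y, f y ∂μ|} ≤
      M ^ 2 / (t * ε ^ 2) := by
  have ht' : (0 : ℝ) < t := by exact_mod_cast ht
  have hIcc : ∀ᵐ x ∂μ, f x ∈ Set.Icc (-M) M := hM.mono fun x hx => abs_le.1 hx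
  have hL : MemLp f 2 μ := memLp_of_bounded hIcc hf.aestronglyMeasurable 2
  have hLi : ∀ i : Fin t, MemLp (fun x : Fin t → Ω => f (x i)) 2 (Measure.pi fun _ : Fin t => μ) :=
    fun i => hL.comp_measurePreserving (measurePreserving_eval (fun _ : Fin t => μ) i)
  have hS : MemLp (∑ i, fun x : Fin t → Ω => f (x i)) 2 (Measure.pi fun _ : Fin t => μ) :=
    memLp_finsetSum' _ fun i _ => hLi i
  have hvar : Var[∑ i, fun x : Fin t → Ω => f (x i); Measure.pi fun _ : Fin t => μ] ≤ t * M ^ 2 := by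
    rw [variance_sum_pi (fun _ => hL)]
    have := variance_le_sq_of_bounded hIcc hf.aemeasurable
    simp only [Finset.sum_const, Finset.card_univ, Fintype.card_fin, nsmul_eq_mul]
    gcongr
    rwa [sub_neg_eq_add, add_self_div_two] at this
  have hint : ∫ x, (∑ i, fun x : Fin t → Ω => f (x i)) x ∂(Measure.pi fun _ : Fin t => μ) =
      t * ∫ y, f y ∂μ := by
    simp only [Finset.sum_apply]
    rw [integral_finsetSum _ fun i _ => (hLi i).integrable (by norm_num)]
    simp [integral_comp_eval (μ := fun _ : Fin t => μ) hf.aestronglyMeasurable]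
  have := meas_ge_le_variance_div_sq hS (c := t * ε) (by positivity)
  rw [hint] at this
  simp only [Finset.sum_apply] at this
  rw [measureReal_def]
  refine ENNReal.toReal_le_of_le_ofReal (by positivity) (this.trans (ENNReal.ofReal_le_ofReal ?_))
  calc _ ≤ t * M ^ 2 / (t * ε) ^ 2 := by gcongr
    _ = M ^ 2 / (t * ε ^ 2) := by field_simp

/-- A bounded statistic whose expectations under the two trace laws are separated distinguishes the
graphs: compare its empirical mean with a threshold between the two expectations. -/
theorem distinguishableFromTraces_of_statistic {V W : Type*} [Finite V] [Finite W]
    {G : SimpleGraph V} {H : SimpleGraph W} {pv pe : unitInterval} (f : UnlabeledGraph → ℝ)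
    {M : ℝ} (hG : ∀ᵐ x ∂edgeDeletionTrace G pv pe, |f x| ≤ M)
    (hH : ∀ᵐ x ∂edgeDeletionTrace H pv pe, |f x| ≤ M) {ε : ℝ} (hε : 0 < ε)
    (hgap : ∫ x, f x ∂edgeDeletionTrace H pv pe + 2 * ε ≤ ∫ x, f x ∂edgeDeletionTrace G pv pe)
    {t : ℕ} (ht : 0 < t) {δ : ℝ} (hδ : M ^ 2 / (t * ε ^ 2) ≤ δ) :
    DistinguishableFromTraces G H pv pe t δ := by
  classical
  have hf : Measurable f := .of_discrete
  have ht' : (0 : ℝ) < t := by exact_mod_cast ht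
  let S : (Fin t → UnlabeledGraph) → ℝ := fun x => ∑ i, f (x i)
  have hS : Measurable S := Finset.measurable_sum _ fun i _ => hf.comp (measurable_pi_apply i)
  set g := ∫ x, f x ∂edgeDeletionTrace G pv pe
  set h := ∫ x, f x ∂edgeDeletionTrace H pv pe
  refine ⟨fun x => decide (t * (h + ε) < S x), ?_, ?_⟩
  · have hm : MeasurableSet {x | t * (h + ε) < S x} := measurableSet_lt measurable_const hS
    have hle := measureReal_pi_le_of_average _ hf hG ht hε
    simp only [decide_eq_true_eq]
    rw [← compl_compl {x | t * (h + ε) < S x}, probReal_compl_eq_one_sub hm.compl]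
    refine sub_le_sub_left ((measureReal_mono ?_).trans (hle.trans hδ)) 1
    intro x hx
    have hx : S x ≤ t * (h + ε) := not_lt.1 hx
    have : (t : ℝ) * (h + 2 * ε) ≤ t * g := by gcongr
    exact le_trans (by linarith) (neg_le_abs (S x - t * g))
  · have hm : MeasurableSet {x | t * (h + ε) < S x} := measurableSet_lt measurable_const hS
    have hle := measureReal_pi_le_of_average _ hf hH ht hε
    simp only [decide_eq_false_iff_not]
    change 1 - δ ≤ (Measure.pi fun _ : Fin t => edgeDeletionTrace H pv pe).real
      {x | t * (h + ε) < S x}ᶜ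
    rw [probReal_compl_eq_one_sub hm]
    refine sub_le_sub_left ((measureReal_mono ?_).trans (hle.trans hδ)) 1
    intro x hx
    have hx : t * (h + ε) < S x := hx
    exact le_trans (by linarith) (le_abs_self (S x - t * h))

/-- The number `⌈n ^ (8 + c)⌉` of samples that Chebyshev's inequality requires for a statistic
bounded by `n ^ 4` is within the subexponential budget, as
`log n ≤ n ^ (1 / 3) * (log n) ^ (2 / 3)`. -/
theorem exists_sampleSize {c : ℝ} (hc : 0 < c) {n : ℕ} (hn : 8 ≤ n) :
    ∃ t : ℕ, 0 < t ∧ (t : ℝ) ≤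
        Real.exp ((9 + c) * (n : ℝ) ^ (1 / 3 : ℝ) * Real.log n ^ (2 / 3 : ℝ)) ∧
      ((n : ℝ) ^ 4) ^ 2 / t ≤ (n : ℝ) ^ (-c) := by
  have hn8 : (8 : ℝ) ≤ n := by exact_mod_cast hn
  have hn0 : (0 : ℝ) < n := by linarith
  have hlog : 0 < Real.log n := Real.log_pos (by linarith)
  have hpow : 0 < (n : ℝ) ^ (8 + c) := by positivity
  have hpow1 : 1 ≤ (n : ℝ) ^ (8 + c) := Real.one_le_rpow (by linarith) (by linarith)
  refine ⟨⌈(n : ℝ) ^ (8 + c)⌉₊, Nat.ceil_pos.2 hpow, ?_, ?_⟩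
  · have hloglog : Real.log n ≤ (n : ℝ) ^ (1 / 3 : ℝ) * Real.log n ^ (2 / 3 : ℝ) := by
      calc Real.log n = Real.log n ^ (1 / 3 : ℝ) * Real.log n ^ (2 / 3 : ℝ) := by
            rw [← Real.rpow_add hlog]; norm_num
        _ ≤ _ := by
            gcongr
            exact (Real.log_le_sub_one_of_pos hn0).trans (by linarith)
    calc (⌈(n : ℝ) ^ (8 + c)⌉₊ : ℝ) ≤ (n : ℝ) ^ (8 + c) + 1 := (Nat.ceil_lt_add_one hpow.le).le
      _ ≤ (n : ℝ) ^ (8 + c) * n := by nlinarith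
      _ = (n : ℝ) ^ (9 + c) := by rw [← Real.rpow_add_one hn0.ne']; ring_nf
      _ = Real.exp ((9 + c) * Real.log n) := by rw [Real.rpow_def_of_pos hn0, mul_comm]
      _ ≤ _ := by
        rw [mul_assoc]
        gcongr
  · rw [div_le_iff₀ (by exact_mod_cast Nat.ceil_pos.2 hpow)]
    calc ((n : ℝ) ^ 4) ^ 2 = (n : ℝ) ^ (-c) * (n : ℝ) ^ (8 + c) := by
          rw [← Real.rpow_add hn0, ← pow_mul, ← Real.rpow_natCast]; norm_num
      _ ≤ _ := by gcongr; exact Nat.le_ceil _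

end GraphTrace

open GraphTrace in
theorem proposition5p1 :
    (∀ r : ℕ, 1 ≤ r →
      Nat.card (PathsVertex r (r - 1) (r - 1) r) = 16 * r - 8 ∧
      Nat.card (PathsVertex (r - 1) r r (r - 1)) = 16 * r - 8 ∧
      IsEmpty (graphOne r ≃g graphTwo r) ∧
      (crossPairsOne r).Nonempty ∧ crossPairsOne r ⊆ (graphOne r).edgeSet ∧
      (crossPairsTwo r).Nonempty ∧ crossPairsTwo r ⊆ (graphTwo r).edgeSet ∧
      ∀ e₁ ∈ crossPairsOne r, ∀ e₂ ∈ crossPairsTwo r,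
        Nonempty ((graphOne r).deleteEdges {e₁} ≃g (graphTwo r).deleteEdges {e₂})) ∧
    (∀ c : ℝ, 0 < c → ∃ C : ℝ, 0 < C ∧ ∀ r n : ℕ, 1 ≤ r → n = 16 * r - 8 →
      ∃ t : ℕ,
        (t : ℝ) ≤ Real.exp (C * (n : ℝ) ^ (1 / 3 : ℝ) * Real.log n ^ (2 / 3 : ℝ)) ∧
        DistinguishableFromTraces (graphOne r) (graphTwo r) 1 oneHalf t ((n : ℝ) ^ (-c))) := by
  have card_one : ∀ r : ℕ, 1 ≤ r → Nat.card (PathsVertex r (r - 1) (r - 1) r) = 16 * r - 8 := by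
    intro r hr
    rw [card_pathsVertex]
    omega
  have card_two : ∀ r : ℕ, 1 ≤ r → Nat.card (PathsVertex (r - 1) r r (r - 1)) = 16 * r - 8 := by
    intro r hr
    rw [card_pathsVertex]
    omega
  constructor
  · intro r hr
    refine ⟨card_one r hr, card_two r hr, ?_⟩
    obtain ⟨s, rfl⟩ := Nat.exists_eq_add_of_le' hr
    exact ⟨isEmpty_graphOne_iso_graphTwo s, crossPairsOne_nonempty s, crossPairsOne_subset _,
      crossPairsTwo_nonempty s, crossPairsTwo_subset _,
      fun e₁ h₁ e₂ h₂ => nonempty_deleteEdges_iso s h₁ h₂⟩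
  · intro c hc
    refine ⟨9 + c, by linarith, fun r n hr hn => ?_⟩
    obtain ⟨t, ht, htle, hδ⟩ := exists_sampleSize hc (n := n) (by omega)
    refine ⟨t, htle, ?_⟩
    have bound_one := abs_traceStatistic_le (graphOne r)
    have bound_two := abs_traceStatistic_le (graphTwo r)
    rw [card_one r hr, ← hn] at bound_one
    rw [card_two r hr, ← hn] at bound_two
    refine distinguishableFromTraces_of_statistic traceStatistic bound_one bound_two one_pos ?_ ht
      (by simpa using hδ)
    obtain ⟨s, rfl⟩ := Nat.exists_eq_add_of_le' hr
    rw [integral_traceStatistic, integral_traceStatistic, pathCount_compl_graphOne, mul_one]
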